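/- For a nonempty open set $\Omega\subseteq\mathbb{C}$ let $\mathcal{A}(\Omega)$ be the set of complex analytic functions on $\Omega$, regarded as a Lie ring under pointwise addition and the bracket $[f,g]=fg'-f'g$. (A Lie ring isomorphism is a bijection that preserves addition and the bracket; no compatibility with complex scalars and no continuity is required.) A conformal mapping between open sets $\Omega_1,\Omega_2\subseteq\mathbb{C}$ is a bijection $\gamma:\Omega_1\to\Omega_2$ such that $\gamma$ and $\gamma^{-1}$ are analytic; a bijection $\gamma:\Omega_1\to\Omega_2$ is anti-conformal if $\overline{\gamma}:\Omega_1\to\{\overline{w} : w\in\Omega_2\}$ is a conformal mapping. **Theorem.** Let $\Omega_1,\Omega_2\subseteq\mathbb{C}$ be nonempty connected open sets and let $\varphi:\mathcal{A}(\Omega_1)\to\mathcal{A}(\Omega_2)$ be a Lie ring isomorphism. Then there is a bijection $\gamma:\Omega_1\to\Omega_2$ such that either $\gamma$ is conformal and $$\varphi(f)=\frac{f\circ\gamma^{-1}}{(\gamma^{-1})'}\qquad\text{for all } f\in\mathcal{A}(\Omega_1),$$ or $\gamma$ is anti-conformal and $$\varphi(f)=\frac{\overline{f\circ\gamma^{-1}}}{\left(\overline{\gamma^{-1}}\right)'}\qquad\text{for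 all } f\in\mathcal{A}(\Omega_1).$$ -/

import Mathlib

open TopologicalSpace ComplexConjugate

noncomputable section

/-- The extension by zero of a function on the open set `Ω`. Since `Ω` is open, neither analyticity
nor the derivative at a point of `Ω` depends on the values chosen outside `Ω`. -/
def zeroExt {Ω : Opens ℂ} (f : Ω → ℂ) : ℂ → ℂ := Function.extend Subtype.val f 0

/-- `f : Ω → ℂ` is complex analytic on the open set `Ω`. -/
def IsAnalytic {Ω : Opens ℂ} (f : Ω → ℂ) : Prop := ∀ z : Ω, AnalyticAt ℂ (zeroExt f) z

/-- The complex derivative `f'` of a function `f : Ω → ℂ`. -/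
def cderiv {Ω : Opens ℂ} (f : Ω → ℂ) : Ω → ℂ := fun z => deriv (zeroExt f) z

theorem zeroExt_apply {Ω : Opens ℂ} (f : Ω → ℂ) (z : Ω) : zeroExt f z = f z :=
  Subtype.val_injective.extend_apply f 0 z

theorem zeroExt_eventuallyEq {Ω : Opens ℂ} {f : Ω → ℂ} {F : ℂ → ℂ} (h : ∀ z : Ω, f z = F z)
    (z : Ω) : zeroExt f =ᶠ[nhds (z : ℂ)] F := by
  filter_upwards [Ω.isOpen.mem_nhds z.2] with w hw
  exact (zeroExt_apply f ⟨w, hw⟩).trans (h ⟨w, hw⟩)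

theorem isAnalytic_of_eq {Ω : Opens ℂ} {f : Ω → ℂ} {F : ℂ → ℂ} (h : ∀ z : Ω, f z = F z)
    (hF : ∀ z : Ω, AnalyticAt ℂ F z) : IsAnalytic f :=
  fun z => (hF z).congr (zeroExt_eventuallyEq h z).symm

theorem cderiv_of_eq {Ω : Opens ℂ} {f : Ω → ℂ} {F : ℂ → ℂ} (h : ∀ z : Ω, f z = F z) (z : Ω) :
    cderiv f z = deriv F z :=
  (zeroExt_eventuallyEq h z).deriv_eq

namespace IsAnalytic

variable {Ω : Opens ℂ} {f g : Ω → ℂ}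

theorem zero : IsAnalytic (0 : Ω → ℂ) :=
  isAnalytic_of_eq (F := fun _ => 0) (fun _ => rfl) fun _ => analyticAt_const

theorem add (hf : IsAnalytic f) (hg : IsAnalytic g) : IsAnalytic (f + g) :=
  isAnalytic_of_eq (F := zeroExt f + zeroExt g) (by simp [zeroExt_apply])
    fun z => (hf z).add (hg z)

theorem neg (hf : IsAnalytic f) : IsAnalytic (-f) :=
  isAnalytic_of_eq (F := -zeroExt f) (by simp [zeroExt_apply]) fun z => (hf z).neg

theorem sub (hf : IsAnalytic f) (hg : IsAnalytic g) : IsAnalytic (f - g) :=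
  isAnalytic_of_eq (F := zeroExt f - zeroExt g) (by simp [zeroExt_apply])
    fun z => (hf z).sub (hg z)

theorem mul (hf : IsAnalytic f) (hg : IsAnalytic g) : IsAnalytic (f * g) :=
  isAnalytic_of_eq (F := zeroExt f * zeroExt g) (by simp [zeroExt_apply])
    fun z => (hf z).mul (hg z)

theorem cderiv (hf : IsAnalytic f) : IsAnalytic (cderiv f) :=
  isAnalytic_of_eq (F := deriv (zeroExt f)) (fun _ => rfl) fun z => (hf z).deriv

theorem cderiv_add (hf : IsAnalytic f) (hg : IsAnalytic g) :
    _root_.cderiv (f + g) = _root_.cderiv f + _root_.cderiv g := by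
  funext z
  rw [cderiv_of_eq (F := zeroExt f + zeroExt g) (by simp [zeroExt_apply]),
    deriv_add (hf z).differentiableAt (hg z).differentiableAt]
  rfl

theorem cderiv_sub (hf : IsAnalytic f) (hg : IsAnalytic g) :
    _root_.cderiv (f - g) = _root_.cderiv f - _root_.cderiv g := by
  funext z
  rw [cderiv_of_eq (F := zeroExt f - zeroExt g) (by simp [zeroExt_apply]),
    deriv_sub (hf z).differentiableAt (hg z).differentiableAt]
  rfl

theorem cderiv_mul (hf : IsAnalytic f) (hg : IsAnalytic g) :
    _root_.cderiv (f * g) = _root_.cderiv f * g + f * _root_.cderiv g := by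
  funext z
  rw [cderiv_of_eq (F := zeroExt f * zeroExt g) (by simp [zeroExt_apply]),
    deriv_mul (hf z).differentiableAt (hg z).differentiableAt, zeroExt_apply, zeroExt_apply]
  rfl

end IsAnalytic

/-- The additive group of complex analytic functions on `Ω`, with pointwise addition. -/
def analyticFunctions (Ω : Opens ℂ) : AddSubgroup (Ω → ℂ) where
  carrier := {f | IsAnalytic f}
  zero_mem' := IsAnalytic.zero
  add_mem' := IsAnalytic.add
  neg_mem' := IsAnalytic.neg

/-- `𝒜 Ω` is the type of complex analytic functions on the open set `Ω`. -/
abbrev 𝒜 (Ω : Opens ℂ) : Type := analyticFunctions Ω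

/-- The bracket `[f, g] = f g' - f' g`. -/
instance (Ω : Opens ℂ) : Bracket (𝒜 Ω) (𝒜 Ω) where
  bracket f g := ⟨f.1 * cderiv g.1 - cderiv f.1 * g.1,
    (IsAnalytic.mul f.2 (IsAnalytic.cderiv g.2)).sub (IsAnalytic.mul (IsAnalytic.cderiv f.2) g.2)⟩

theorem coe_bracket {Ω : Opens ℂ} (f g : 𝒜 Ω) :
    (⁅f, g⁆ : 𝒜 Ω).1 = f.1 * cderiv g.1 - cderiv f.1 * g.1 := rfl

theorem cderiv_coe_bracket {Ω : Opens ℂ} (f g : 𝒜 Ω) :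
    cderiv (⁅f, g⁆ : 𝒜 Ω).1 = f.1 * cderiv (cderiv g.1) - cderiv (cderiv f.1) * g.1 := by
  have hf : IsAnalytic f.1 := f.2
  have hg : IsAnalytic g.1 := g.2
  rw [coe_bracket, IsAnalytic.cderiv_sub (hf.mul hg.cderiv) (hf.cderiv.mul hg),
    IsAnalytic.cderiv_mul hf hg.cderiv, IsAnalytic.cderiv_mul hf.cderiv hg]
  ring

/-- The Lie ring of complex analytic functions on `Ω`. -/
instance (Ω : Opens ℂ) : LieRing (𝒜 Ω) where
  add_lie x y z := by
    apply Subtype.ext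
    simp only [coe_bracket, AddSubgroup.coe_add, IsAnalytic.cderiv_add x.2 y.2]
    ring
  lie_add x y z := by
    apply Subtype.ext
    simp only [coe_bracket, AddSubgroup.coe_add, IsAnalytic.cderiv_add y.2 z.2]
    ring
  lie_self x := by
    apply Subtype.ext
    simp only [coe_bracket, AddSubgroup.coe_zero]
    ring
  leibniz_lie x y z := by
    apply Subtype.ext
    rw [AddSubgroup.coe_add, coe_bracket x ⁅y, z⁆, coe_bracket ⁅x, y⁆ z, coe_bracket y ⁅x, z⁆,
      cderiv_coe_bracket, cderiv_coe_bracket, cderiv_coe_bracket, coe_bracket, coe_bracket,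
      coe_bracket]
    ring

/-- A conformal mapping: a bijection `γ : Ω₁ → Ω₂` such that `γ` and `γ⁻¹` are analytic. -/
def IsConformal {Ω₁ Ω₂ : Opens ℂ} (γ : Ω₁ ≃ Ω₂) : Prop :=
  IsAnalytic (fun z => (γ z : ℂ)) ∧ IsAnalytic (fun w => (γ.symm w : ℂ))

/-- The complex conjugate `{conj w | w ∈ Ω}` of the open set `Ω` (as the preimage of `Ω` under the
involution `conj`). -/
def conjOpens (Ω : Opens ℂ) : Opens ℂ :=
  ⟨{w | conj w ∈ Ω}, Ω.isOpen.preimage Complex.continuous_conj⟩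

/-- Complex conjugation as a bijection from `Ω` onto its complex conjugate. -/
def conjEquiv (Ω : Opens ℂ) : Ω ≃ conjOpens Ω where
  toFun w := ⟨conj (w : ℂ), by simp [conjOpens, ← SetLike.mem_coe]⟩
  invFun w := ⟨conj (w : ℂ), w.2⟩
  left_inv w := by simp
  right_inv w := by simp

/-- An anti-conformal mapping: a bijection `γ : Ω₁ → Ω₂` whose complex conjugate is a conformal
mapping of `Ω₁` onto the complex conjugate of `Ω₂`. -/
def IsAntiConformal {Ω₁ Ω₂ : Opens ℂ} (γ : Ω₁ ≃ Ω₂) : Prop :=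
  IsConformal (γ.trans (conjEquiv Ω₂))

end

/-! The Lie ring alone recovers both the scalars and the points. On a connected set [f, g] = 0 with
f ≠ 0 forces g to be a multiple of f, so φ sends complex lines into complex lines; comparing [cf, g]
= [f, cg] shows that all scalars transform by one field automorphism σ
(`exists_ringEquiv_map_smul`).

Points are seen through Lie subalgebras of codimension one: the functions vanishing at w form one,
and conversely the members of any such subalgebra share a zero
(`exists_apply_eq_zero_of_lie_closed_ker`). Pulling back evaluation at w gives φ(f)(w) = σ(f(ψ(w)))
φ(1)(w), and [1, z] = 1 identifies φ(1) with 1/H', where H = σ ∘ ψ.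

A wild σ would be unbounded near 0. Some entire f would then make σ(f(ψ(w_n))) unbounded along
distinct points w_n converging in Ω₂, against the continuity of φ(f)H' (`exists_entire_le_norm`). So
σ is continuous, hence the identity or conjugation: the two cases. -/

/-! ### Semilinearity from one-dimensional centralizers -/

section Semilinear

variable {K L₁ L₂ : Type*} [Field K] [LieRing L₁] [LieAlgebra K L₁] [LieRing L₂] [LieAlgebra K L₂]

/-- A Lie ring isomorphism between nonabelian Lie algebras in which the centralizer of a nonzero
element is the line through it is semilinear. -/
theorem exists_ringHom_map_smul (φ : L₁ ≃ₗ⁅ℤ⁆ L₂)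
    (h₁ : ∀ f g : L₁, f ≠ 0 → ⁅f, g⁆ = 0 → ∃ c : K, g = c • f)
    (h₂ : ∀ f g : L₂, f ≠ 0 → ⁅f, g⁆ = 0 → ∃ c : K, g = c • f)
    (hL : ∃ f g : L₁, ⁅f, g⁆ ≠ 0) :
    ∃ σ : K →+* K, ∀ (c : K) (f : L₁), φ (c • f) = σ c • φ f := by
  have hne : ∀ f, f ≠ 0 → φ f ≠ 0 := fun f hf h =>
    hf (φ.injective (h.trans (map_zero φ).symm))
  have hline : ∀ (f : L₁) (c : K), ∃ s : K, φ (c • f) = s • φ f := by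
    intro f c
    by_cases hf : f = 0
    · exact ⟨0, by simp [hf]⟩
    · apply h₂ _ _ (hne f hf)
      rw [← LieEquiv.map_lie, lie_smul, lie_self, smul_zero, map_zero]
  have key : ∀ (f g : L₁) (c s t : K), ⁅f, g⁆ ≠ 0 → φ (c • f) = s • φ f →
      φ (c • g) = t • φ g → s = t := by
    intro f g c s t hfg hs ht
    have h : φ ⁅c • f, g⁆ = φ ⁅f, c • g⁆ := by rw [smul_lie, lie_smul]
    rw [LieEquiv.map_lie, LieEquiv.map_lie, hs, ht, smul_lie, lie_smul, ← LieEquiv.map_lie] at h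
    exact smul_left_injective K (hne _ hfg) h
  obtain ⟨f₀, g₀, h₀⟩ := hL
  choose s hs using hline
  have hf₀ : f₀ ≠ 0 := by rintro rfl; simp at h₀
  have main : ∀ (c : K) (g : L₁), φ (c • g) = s f₀ c • φ g := by
    intro c g
    by_cases hg : g = 0
    · simp [hg]
    -- A multiple of `f₀` cannot be compared with `f₀` directly; both are compared with `g₀`.
    by_cases hfg : ⁅f₀, g⁆ = 0
    · obtain ⟨d, rfl⟩ := h₁ _ _ hf₀ hfg
      have hd : d ≠ 0 := by rintro rfl; simp at hg
      have hgg : ⁅d • f₀, g₀⁆ ≠ 0 := by rw [smul_lie]; exact smul_ne_zero hd h₀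
      rw [hs, key _ _ c _ _ hgg (hs _ _) (hs _ _), ← key _ _ c _ _ h₀ (hs _ _) (hs _ _)]
    · rw [hs, key _ _ c _ _ hfg (hs _ _) (hs _ _)]
  have inj : Function.Injective fun c : K => c • φ f₀ := smul_left_injective K (hne _ hf₀)
  refine ⟨⟨⟨⟨s f₀, inj ?_⟩, fun a b => inj ?_⟩, inj ?_, fun a b => inj ?_⟩, main⟩
  · simp only [← main, one_smul]
  · simp only [mul_smul, ← main]
  · simp only [← main, zero_smul, map_zero]
  · simp only [add_smul, ← main, map_add]

/-- The semilinearity of `exists_ringHom_map_smul`, with respect to a field automorphism. -/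
theorem exists_ringEquiv_map_smul (φ : L₁ ≃ₗ⁅ℤ⁆ L₂)
    (h₁ : ∀ f g : L₁, f ≠ 0 → ⁅f, g⁆ = 0 → ∃ c : K, g = c • f)
    (h₂ : ∀ f g : L₂, f ≠ 0 → ⁅f, g⁆ = 0 → ∃ c : K, g = c • f)
    (hL : ∃ f g : L₁, ⁅f, g⁆ ≠ 0) :
    ∃ σ : K ≃+* K, ∀ (c : K) (f : L₁), φ (c • f) = σ c • φ f := by
  obtain ⟨σ, hσ⟩ := exists_ringHom_map_smul φ h₁ h₂ hL
  obtain ⟨f, g, hfg⟩ := hL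
  have hf : φ f ≠ 0 := by
    intro h
    obtain rfl : f = 0 := φ.injective (h.trans (map_zero φ).symm)
    simp at hfg
  refine ⟨RingEquiv.ofBijective σ ⟨σ.injective, fun c => ?_⟩, hσ⟩
  obtain ⟨τ, hτ⟩ := exists_ringHom_map_smul φ.symm h₂ h₁ ⟨φ f, φ g, by
    rw [← LieEquiv.map_lie]
    exact fun h => hfg (φ.injective (h.trans (map_zero φ).symm))⟩
  refine ⟨τ c, smul_left_injective K hf ?_⟩
  have h := congrArg φ (hτ c (φ f))
  rw [LieEquiv.apply_symm_apply, LieEquiv.symm_apply_apply, hσ] at h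
  exact h.symm

end Semilinear

/-! ### Discontinuous field endomorphisms of ℂ -/

/-- For a sequence of distinct points `p n` and a field endomorphism `σ` of `ℂ` that is unbounded
near `0`, some entire function `f` has `σ (f (p n))` unbounded. -/
theorem exists_entire_le_norm (σ : ℂ →+* ℂ) (p : ℕ → ℂ) (hp : Function.Injective p)
    (hσ : ∀ δ > 0, ∀ M : ℝ, ∃ z : ℂ, ‖z‖ < δ ∧ M < ‖σ z‖) :
    ∃ f : ℂ → ℂ, Differentiable ℂ f ∧ ∀ n : ℕ, n ≤ ‖σ (f (p n))‖ := by
  -- The function is a Newton series Σ c_k P_k. Terms with k > n vanish at `p n`, so the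
  -- coefficients can be chosen one after another.
  let P : ℕ → ℂ → ℂ := fun n z => ∏ k ∈ Finset.range n, (z - p k)
  have hP : ∀ n, P n (p n) ≠ 0 := fun n => Finset.prod_ne_zero_iff.2 fun k hk =>
    sub_ne_zero.2 fun h => (Finset.mem_range.1 hk).ne' (hp h)
  let d : ℕ → ℝ := fun n => ∏ k ∈ Finset.range n, (1 + ‖p k‖)
  have hd : ∀ n, 0 < d n := fun n => Finset.prod_pos fun k _ => by positivity
  have hPd : ∀ n z, ‖P n z‖ ≤ d n * (1 + ‖z‖) ^ n := by
    intro n z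
    have : (1 + ‖z‖) ^ n = ∏ k ∈ Finset.range n, (1 + ‖z‖) := by simp
    rw [this, ← Finset.prod_mul_distrib, norm_prod]
    refine Finset.prod_le_prod (fun _ _ => norm_nonneg _) fun k _ => ?_
    have := norm_sub_le z (p k)
    nlinarith [norm_nonneg z, norm_nonneg (p k), mul_nonneg (norm_nonneg z) (norm_nonneg (p k))]
  -- The value `a` is the partial sum at `p n`. Unboundedness of σ near 0 lets σ(c P_n(p_n))
  -- outweigh σ(a) with `c` small enough for domination by an exponential series.
  have hstep : ∀ (n : ℕ) (a : ℂ), ∃ c : ℂ, ‖c‖ ≤ 1 / (d n * n.factorial) ∧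
      n ≤ ‖σ (a + c * P n (p n))‖ := by
    intro n a
    have hpos : 0 < ‖σ (P n (p n))‖ := norm_pos_iff.2 ((map_ne_zero σ).2 (hP n))
    obtain ⟨c, hc, hM⟩ := hσ (1 / (d n * n.factorial))
      (by have := hd n; positivity) ((n + ‖σ a‖) / ‖σ (P n (p n))‖)
    refine ⟨c, hc.le, ?_⟩
    rw [div_lt_iff₀ hpos, ← norm_mul, ← map_mul] at hM
    have := norm_sub_le (σ (a + c * P n (p n))) (σ a)
    rw [map_add, add_sub_cancel_left, ← map_add] at this
    linarith
  choose E hE hE' using hstep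
  let S : ℕ → ℂ → ℂ := fun n => Nat.rec 0 (fun n S z => S z + E n (S (p n)) * P n z) n
  let c : ℕ → ℂ := fun n => E n (S n (p n))
  have hS : ∀ n z, S n z = ∑ k ∈ Finset.range n, c k * P k z := by
    intro n z
    induction n with
    | zero => simp [S]
    | succ n ih => rw [Finset.sum_range_succ, ← ih]
  have hbound : ∀ k z, ‖c k * P k z‖ ≤ (1 + ‖z‖) ^ k / k.factorial := by
    intro k z
    have hk := hd k
    calc ‖c k * P k z‖ ≤ 1 / (d k * k.factorial) * (d k * (1 + ‖z‖) ^ k) := by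
          rw [norm_mul]
          exact mul_le_mul (hE _ _) (hPd k z) (norm_nonneg _) (by positivity)
      _ = (1 + ‖z‖) ^ k / k.factorial := by field_simp
  refine ⟨fun z => ∑' k, c k * P k z, fun z => ?_, fun n => ?_⟩
  · have h := Complex.differentiableOn_tsum_of_summable_norm (U := Metric.ball 0 (‖z‖ + 1))
      (F := fun k z => c k * P k z)
      (Real.summable_pow_div_factorial (1 + (‖z‖ + 1)))
      (fun k => by fun_prop) Metric.isOpen_ball (fun k w hw => by
        refine (hbound k w).trans ?_
        have : ‖w‖ < ‖z‖ + 1 := by simpa using hw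
        gcongr)
    exact h.differentiableAt (Metric.isOpen_ball.mem_nhds (by simp))
  · have h : ∑' k, c k * P k (p n) = ∑ k ∈ Finset.range (n + 1), c k * P k (p n) := by
      refine tsum_eq_sum fun k hk => ?_
      have hnk : n ∈ Finset.range k := by simp at hk ⊢; omega
      exact mul_eq_zero_of_right _ (Finset.prod_eq_zero hnk (sub_self _))
    simp only [h]
    rw [Finset.sum_range_succ, ← hS]
    exact hE' n _

/-- A field endomorphism of `ℂ` that is bounded near `0` is continuous. -/
theorem continuous_of_norm_le (σ : ℂ →+* ℂ) {δ M : ℝ} (hδ : 0 < δ)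
    (h : ∀ z : ℂ, ‖z‖ < δ → ‖σ z‖ ≤ M) : Continuous σ := by
  refine continuous_of_continuousAt_zero σ.toAddMonoidHom ?_
  rw [Metric.continuousAt_iff]
  intro ε hε
  -- Since σ fixes the natural numbers, (n + 1)‖σ z‖ = ‖σ((n + 1)z)‖ ≤ M for ‖z‖ < δ/(n + 1).
  obtain ⟨n, hn⟩ := exists_nat_gt (M / ε)
  have hn' : M < (n + 1 : ℕ) * ε := by
    rw [div_lt_iff₀ hε] at hn
    push_cast
    linarith
  refine ⟨δ / (n + 1 : ℕ), by positivity, fun z hz => ?_⟩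
  rw [dist_zero_right, lt_div_iff₀ (by positivity)] at hz
  have h1 := h ((n + 1 : ℕ) * z) (by rw [norm_mul, Complex.norm_natCast, mul_comm]; exact hz)
  rw [map_mul, map_natCast, norm_mul, Complex.norm_natCast] at h1
  change dist (σ z) (σ 0) < ε
  rw [map_zero, dist_zero_right]
  exact lt_of_mul_lt_mul_left (h1.trans_lt hn') (by positivity)

/-! ### The algebra of analytic functions and its centralizers -/

namespace IsAnalytic

variable {Ω : Opens ℂ} {f : Ω → ℂ}

theorem const (c : ℂ) : IsAnalytic (fun _ : Ω => c) :=
  isAnalytic_of_eq (F := fun _ => c) (fun _ => rfl) fun _ => analyticAt_const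

theorem const_smul (c : ℂ) (hf : IsAnalytic f) : IsAnalytic (c • f) := (const c).mul hf

theorem cderiv_const_smul (c : ℂ) (hf : IsAnalytic f) :
    _root_.cderiv (c • f) = c • _root_.cderiv f := by
  funext z
  rw [cderiv_of_eq (F := c • zeroExt f) (by simp [zeroExt_apply]),
    deriv_const_smul _ (hf z).differentiableAt]
  rfl

theorem div {g : Ω → ℂ} (hf : IsAnalytic f) (hg : IsAnalytic g) (h0 : ∀ z, g z ≠ 0) :
    IsAnalytic (f / g) :=
  isAnalytic_of_eq (F := zeroExt f / zeroExt g) (by simp [zeroExt_apply])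
    fun z => (hf z).div (hg z) (by rw [zeroExt_apply]; exact h0 z)

theorem continuous (hf : IsAnalytic f) : Continuous f := by
  refine continuous_iff_continuousAt.2 fun z => ?_
  have h : f = zeroExt f ∘ Subtype.val := funext fun z => (zeroExt_apply f z).symm
  rw [h]
  exact ContinuousAt.comp (hf z).continuousAt continuousAt_subtype_val

theorem restrict (Ω : Opens ℂ) {F : ℂ → ℂ} (hF : Differentiable ℂ F) :
    IsAnalytic (fun z : Ω => F z) :=
  isAnalytic_of_eq (fun _ => rfl) fun z => hF.analyticAt z

end IsAnalytic

namespace analyticFunctions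

variable {Ω : Opens ℂ}

noncomputable instance : CommRing (𝒜 Ω) :=
  { (inferInstance : AddCommGroup (𝒜 Ω)) with
    mul := fun f g => ⟨f.1 * g.1, IsAnalytic.mul f.2 g.2⟩
    one := ⟨fun _ => 1, IsAnalytic.const 1⟩
    mul_assoc := fun _ _ _ => Subtype.ext (mul_assoc _ _ _)
    mul_comm := fun _ _ => Subtype.ext (mul_comm _ _)
    one_mul := fun f => Subtype.ext (one_mul f.1)
    mul_one := fun f => Subtype.ext (mul_one f.1)
    left_distrib := fun _ _ _ => Subtype.ext (mul_add _ _ _)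
    right_distrib := fun _ _ _ => Subtype.ext (add_mul _ _ _)
    zero_mul := fun f => Subtype.ext (zero_mul f.1)
    mul_zero := fun f => Subtype.ext (mul_zero f.1) }

noncomputable instance : Module ℂ (𝒜 Ω) where
  smul c f := ⟨c • f.1, IsAnalytic.const_smul c f.2⟩
  one_smul _ := Subtype.ext (one_smul _ _)
  mul_smul _ _ _ := Subtype.ext (mul_smul _ _ _)
  smul_zero _ := Subtype.ext (smul_zero _)
  smul_add _ _ _ := Subtype.ext (smul_add _ _ _)
  add_smul _ _ _ := Subtype.ext (add_smul _ _ _)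
  zero_smul _ := Subtype.ext (zero_smul _ _)

noncomputable instance : Algebra ℂ (𝒜 Ω) :=
  Algebra.ofModule (fun _ _ _ => Subtype.ext (smul_mul_assoc _ _ _))
    (fun _ _ _ => Subtype.ext (mul_smul_comm _ _ _))

@[simp] theorem add_apply (f g : 𝒜 Ω) (z : Ω) : (f + g).1 z = f.1 z + g.1 z := rfl

@[simp] theorem sub_apply (f g : 𝒜 Ω) (z : Ω) : (f - g).1 z = f.1 z - g.1 z := rfl

@[simp] theorem mul_apply (f g : 𝒜 Ω) (z : Ω) : (f * g).1 z = f.1 z * g.1 z := rfl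

@[simp] theorem one_apply (z : Ω) : (1 : 𝒜 Ω).1 z = 1 := rfl

@[simp] theorem zero_apply (z : Ω) : (0 : 𝒜 Ω).1 z = 0 := rfl

@[simp] theorem smul_apply (c : ℂ) (f : 𝒜 Ω) (z : Ω) : (c • f).1 z = c * f.1 z := rfl

/-- Complex differentiation as a derivation of the algebra of analytic functions. -/
noncomputable def derivation (Ω : Opens ℂ) : Derivation ℂ (𝒜 Ω) (𝒜 Ω) :=
  Derivation.mk'
    { toFun := fun f => ⟨cderiv f.1, IsAnalytic.cderiv f.2⟩
      map_add' := fun f g => Subtype.ext (IsAnalytic.cderiv_add f.2 g.2)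
      map_smul' := fun c f => Subtype.ext (IsAnalytic.cderiv_const_smul c f.2) }
    fun f g => Subtype.ext ((IsAnalytic.cderiv_mul f.2 g.2).trans (by
      rw [add_comm, mul_comm (cderiv f.1)]; rfl))

theorem derivation_apply (f : 𝒜 Ω) (z : Ω) : (derivation Ω f).1 z = cderiv f.1 z := rfl

theorem lie_eq (f g : 𝒜 Ω) : ⁅f, g⁆ = f * derivation Ω g - derivation Ω f * g := rfl

noncomputable instance : LieAlgebra ℂ (𝒜 Ω) where
  lie_smul c f g := by
    rw [lie_eq, lie_eq, Derivation.map_smul, mul_smul_comm, mul_smul_comm, smul_sub]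

/-- The inclusion `Ω → ℂ` as an analytic function. -/
noncomputable def coord (Ω : Opens ℂ) : 𝒜 Ω := ⟨fun z => z, IsAnalytic.restrict Ω differentiable_id⟩

@[simp] theorem coord_apply (z : Ω) : (coord Ω).1 z = z := rfl

@[simp] theorem derivation_coord : derivation Ω (coord Ω) = 1 := by
  refine Subtype.ext (funext fun z => ?_)
  exact (cderiv_of_eq (F := id) (fun _ => rfl) z).trans (deriv_id _)

theorem one_lie_coord : ⁅(1 : 𝒜 Ω), coord Ω⁆ = 1 := by
  simp [lie_eq]

theorem one_ne_zero_of_nonempty (h : (Ω : Set ℂ).Nonempty) : (1 : 𝒜 Ω) ≠ 0 := by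
  obtain ⟨z, hz⟩ := h
  intro h
  simpa using congrFun (congrArg Subtype.val h) ⟨z, hz⟩

theorem sub_algebraMap_apply (f : 𝒜 Ω) (c : ℂ) (z : Ω) :
    (f - algebraMap ℂ (𝒜 Ω) c).1 z = f.1 z - c := by
  simp [Algebra.algebraMap_eq_smul_one]

/-- Division of `f - f p` by the coordinate function `z - p`. -/
theorem exists_eq_add_sub_mul (f : 𝒜 Ω) (p : Ω) :
    ∃ g : 𝒜 Ω, f = algebraMap ℂ _ (f.1 p) + (coord Ω - algebraMap ℂ _ (p : ℂ)) * g := by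
  have hd : DifferentiableOn ℂ (dslope (zeroExt f.1) p) Ω :=
    (Complex.differentiableOn_dslope (Ω.isOpen.mem_nhds p.2)).2 fun z hz =>
      (f.2 ⟨z, hz⟩).differentiableAt.differentiableWithinAt
  refine ⟨⟨fun z => dslope (zeroExt f.1) p z, isAnalytic_of_eq (fun _ => rfl) fun z =>
    hd.analyticAt (Ω.isOpen.mem_nhds z.2)⟩, Subtype.ext (funext fun z => ?_)⟩
  have h := sub_smul_dslope (zeroExt f.1) p z
  rw [zeroExt_apply, zeroExt_apply, smul_eq_mul] at h
  rw [add_apply, mul_apply, sub_algebraMap_apply, coord_apply, h]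
  simp [Algebra.algebraMap_eq_smul_one]

theorem isUnit_coord_sub {p : ℂ} (hp : p ∉ Ω) :
    IsUnit (coord Ω - algebraMap ℂ (𝒜 Ω) p) := by
  have h0 : ∀ z : Ω, (coord Ω - algebraMap ℂ (𝒜 Ω) p).1 z ≠ 0 := by
    intro z
    rw [sub_algebraMap_apply, coord_apply, sub_ne_zero]
    rintro rfl
    exact hp z.2
  refine IsUnit.of_mul_eq_one ⟨_, IsAnalytic.div (IsAnalytic.const 1)
    (coord Ω - algebraMap ℂ (𝒜 Ω) p).2 h0⟩ (Subtype.ext (funext fun z => ?_))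
  exact mul_one_div_cancel (h0 z)

/-- Near z the derivative of h/f is [f, h]/f² = 0, so h/f keeps its value 0 there; the identity
theorem does the rest. -/
theorem eq_zero_of_lie_eq_zero (hΩ : IsConnected (Ω : Set ℂ)) {f h : 𝒜 Ω} (hfh : ⁅f, h⁆ = 0)
    {z : Ω} (hf : f.1 z ≠ 0) (hh : h.1 z = 0) : h = 0 := by
  have hd : ∀ g : 𝒜 Ω, ∀ w ∈ Ω, DifferentiableAt ℂ (zeroExt g.1) w := fun g w hw =>
    (g.2 ⟨w, hw⟩).differentiableAt
  have hf' : zeroExt f.1 z ≠ 0 := by rwa [zeroExt_apply]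
  have hmem : {w | w ∈ Ω ∧ zeroExt f.1 w ≠ 0} ∈ nhds (z : ℂ) :=
    Filter.inter_mem (Ω.isOpen.mem_nhds z.2) ((f.2 z).continuousAt.eventually_ne hf')
  obtain ⟨r, hr, hball⟩ := Metric.mem_nhds_iff.1 hmem
  have hconst : ∀ w ∈ Metric.ball (z : ℂ) r, (zeroExt h.1 / zeroExt f.1) w = 0 := by
    intro w hw
    have h1 : (zeroExt h.1 / zeroExt f.1) z = 0 := by
      rw [Pi.div_apply, zeroExt_apply, hh, zero_div]
    rw [← h1]
    refine Metric.isOpen_ball.is_const_of_deriv_eq_zero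
      (convex_ball _ _).isPreconnected (fun v hv => ?_) (fun v hv => ?_) hw
      (Metric.mem_ball_self hr)
    · exact ((hd h v (hball hv).1).div (hd f v (hball hv).1) (hball hv).2).differentiableWithinAt
    · rw [deriv_div (hd h v (hball hv).1) (hd f v (hball hv).1) (hball hv).2]
      have this : f.1 ⟨v, (hball hv).1⟩ * deriv (zeroExt h.1) v -
          deriv (zeroExt f.1) v * h.1 ⟨v, (hball hv).1⟩ = 0 :=
        congrFun (congrArg Subtype.val hfh) ⟨v, (hball hv).1⟩
      rw [← zeroExt_apply f.1 ⟨v, _⟩, ← zeroExt_apply h.1 ⟨v, _⟩] at this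
      rw [Pi.zero_apply, div_eq_zero_iff]
      left
      linear_combination this
  have hev : zeroExt h.1 =ᶠ[nhds (z : ℂ)] 0 := by
    filter_upwards [Metric.ball_mem_nhds _ hr] with w hw
    exact (div_eq_zero_iff.1 (hconst w hw)).resolve_right (hball hw).2
  have heq := AnalyticOnNhd.eqOn_zero_of_preconnected_of_eventuallyEq_zero
    (U := (Ω : Set ℂ)) (fun w hw => h.2 ⟨w, hw⟩) hΩ.isPreconnected z.2 hev
  exact Subtype.ext (funext fun w => (zeroExt_apply _ w).symm.trans (heq w.2))

/-- The centralizer of a nonzero analytic function on a connected open set is one-dimensional. -/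
theorem exists_eq_smul_of_lie_eq_zero (hΩ : IsConnected (Ω : Set ℂ)) (f g : 𝒜 Ω) (hf : f ≠ 0)
    (hfg : ⁅f, g⁆ = 0) : ∃ c : ℂ, g = c • f := by
  obtain ⟨z, hz⟩ : ∃ z, f.1 z ≠ 0 := by
    by_contra! h
    exact hf (Subtype.ext (funext h))
  refine ⟨g.1 z / f.1 z, sub_eq_zero.1 (eq_zero_of_lie_eq_zero hΩ (f := f) (z := z) ?_ hz ?_)⟩
  · rw [lie_sub, lie_smul, lie_self, hfg, smul_zero, sub_zero]
  · rw [sub_apply, smul_apply, div_mul_cancel₀ _ hz, sub_self]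

end analyticFunctions

/-! ### Lie subalgebras of codimension one -/

namespace analyticFunctions

open Polynomial

variable {Ω : Opens ℂ}

theorem derivation_aeval_coord (q : ℂ[X]) :
    derivation Ω (aeval (coord Ω) q) = aeval (coord Ω) (derivative q) := by
  rw [Derivation.map_aeval, derivation_coord, smul_eq_mul, mul_one]

/-- The polynomials all of whose multiples in `𝒜 Ω` are annihilated by `l`. -/
noncomputable def annihilatorIdeal (l : 𝒜 Ω →ₗ[ℂ] ℂ) : Ideal ℂ[X] where
  carrier := {q | ∀ g : 𝒜 Ω, l (aeval (coord Ω) q * g) = 0}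
  add_mem' hp hq g := by rw [map_add, add_mul, map_add, hp g, hq g, add_zero]
  zero_mem' g := by rw [map_zero, zero_mul, map_zero]
  smul_mem' c q hq g := by rw [smul_eq_mul, mul_comm c, map_mul (aeval _), mul_assoc, hq]

theorem mem_annihilatorIdeal {l : 𝒜 Ω →ₗ[ℂ] ℂ} {q : ℂ[X]} :
    q ∈ annihilatorIdeal l ↔ ∀ g : 𝒜 Ω, l (aeval (coord Ω) q * g) = 0 := Iff.rfl

/-- By 2qg = [q, zg] - [zq, g], it suffices that q and zq bracket everything into ker l. By `hK`
this amounts to four linear conditions on q, which some nonzero polynomial satisfies. -/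
theorem annihilatorIdeal_ne_bot {l : 𝒜 Ω →ₗ[ℂ] ℂ}
    (hl : ∀ f g, l f = 0 → l g = 0 → l ⁅f, g⁆ = 0) {g₀ : 𝒜 Ω} (hg₀ : l g₀ ≠ 0) :
    annihilatorIdeal l ≠ ⊥ := by
  have hK : ∀ f, l f = 0 → l ⁅f, g₀⁆ = 0 → ∀ g, l ⁅f, g⁆ = 0 := by
    intro f hf hfg g
    have h := hl f (g - (l g / l g₀) • g₀) hf (by
      rw [map_sub, map_smul, smul_eq_mul, div_mul_cancel₀ _ hg₀, sub_self])
    rwa [lie_sub, lie_smul, map_sub, map_smul, hfg, smul_zero, sub_zero] at h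
  let T : ℂ[X] →ₗ[ℂ] 𝒜 Ω := (aeval (coord Ω)).toLinearMap
  let ad : 𝒜 Ω →ₗ[ℂ] ℂ :=
    { toFun := fun f => l ⁅f, g₀⁆
      map_add' := fun f g => by rw [add_lie, map_add]
      map_smul' := fun c f => by rw [smul_lie, map_smul]; rfl }
  let m : 𝒜 Ω →ₗ[ℂ] 𝒜 Ω := LinearMap.mulLeft ℂ (coord Ω)
  let Φ : ℂ[X] →ₗ[ℂ] (ℂ × ℂ) × (ℂ × ℂ) :=
    ((l ∘ₗ T).prod (ad ∘ₗ T)).prod ((l ∘ₗ m ∘ₗ T).prod (ad ∘ₗ m ∘ₗ T))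
  obtain ⟨q, hq, hq0⟩ : ∃ q, Φ q = 0 ∧ q ≠ 0 := by
    by_contra! h
    exact Polynomial.not_finite (R := ℂ)
      (Module.Finite.of_injective Φ ((injective_iff_map_eq_zero Φ).2 h))
  obtain ⟨⟨h1, h2⟩, h3, h4⟩ : (l (T q) = 0 ∧ l ⁅T q, g₀⁆ = 0) ∧
      l (coord Ω * T q) = 0 ∧ l ⁅coord Ω * T q, g₀⁆ = 0 := by
    simpa [Φ, ad, m, Prod.ext_iff] using hq
  refine fun hbot => hq0 ?_
  rw [← Ideal.mem_bot, ← hbot, mem_annihilatorIdeal]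
  intro g
  have e : (2 : ℂ) • (T q * g) = ⁅T q, coord Ω * g⁆ - ⁅coord Ω * T q, g⁆ := by
    simp only [lie_eq, Derivation.leibniz, derivation_coord, smul_eq_mul, two_smul]
    ring
  have h := congrArg l e
  rw [map_smul, map_sub, hK _ h1 h2, hK _ h3 h4, sub_zero, smul_eq_mul] at h
  exact (mul_eq_zero.1 h).resolve_left two_ne_zero

/-- A Lie subalgebra of codimension one consists of functions vanishing at some point. -/
theorem exists_apply_eq_zero_of_lie_closed_ker (l : 𝒜 Ω →ₗ[ℂ] ℂ) (hl0 : l ≠ 0)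
    (hl : ∀ f g, l f = 0 → l g = 0 → l ⁅f, g⁆ = 0) :
    ∃ p : Ω, ∀ f, l f = 0 → f.1 p = 0 := by
  obtain ⟨g₀, hg₀⟩ : ∃ g, l g ≠ 0 := by
    by_contra! h
    exact hl0 (LinearMap.ext h)
  have hbot := annihilatorIdeal_ne_bot hl hg₀
  obtain ⟨q, hq⟩ := (IsPrincipalIdealRing.principal (annihilatorIdeal l)).principal
  have hdvd : ∀ r, r ∈ annihilatorIdeal l ↔ q ∣ r := fun r => by
    rw [hq, Ideal.submodule_span_eq, Ideal.mem_span_singleton]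
  have hq0 : q ≠ 0 := by
    rintro rfl
    exact hbot (hq.trans (by simp))
  have hqI : q ∈ annihilatorIdeal l := (hdvd q).2 dvd_rfl
  have hdeg : q.degree ≠ 0 := by
    intro h
    have h1 := (hdvd 1).2 (isUnit_iff_dvd_one.1 (isUnit_iff_degree_eq_zero.2 h))
    exact hg₀ (by simpa using h1 g₀)
  obtain ⟨p, hp⟩ := IsAlgClosed.exists_root q hdeg
  -- Otherwise z - p is invertible in `𝒜 Ω` and cancels from q, leaving a member of the ideal of
  -- smaller degree than its generator.
  have hpΩ : p ∈ Ω := by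
    by_contra hpΩ
    obtain ⟨r, hr⟩ := dvd_iff_isRoot.2 hp
    obtain ⟨u, hu⟩ := isUnit_coord_sub hpΩ
    have hrI : r ∈ annihilatorIdeal l := by
      intro g
      have h := hqI (↑u⁻¹ * g)
      rw [hr, map_mul (aeval _), map_sub, aeval_X, aeval_C, ← hu] at h
      rwa [mul_comm (u : 𝒜 Ω), mul_assoc, Units.mul_inv_cancel_left] at h
    rw [hdvd] at hrI
    have hr0 : r ≠ 0 := by
      rintro rfl
      exact hq0 (by rw [hr, mul_zero])
    have h := degree_le_of_dvd hrI hr0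
    rw [hr, degree_mul, degree_X_sub_C, degree_eq_natDegree hr0] at h
    norm_cast at h
    omega
  refine ⟨⟨p, hpΩ⟩, fun f hf => ?_⟩
  -- Every term of [f, qg] other than f q' g is a multiple of q, hence killed by `l`.
  have hfq : ∀ g, l (f * aeval (coord Ω) (derivative q) * g) = 0 := by
    intro g
    have h := hl f _ hf (hqI g)
    have e : ⁅f, aeval (coord Ω) q * g⁆ = f * aeval (coord Ω) (derivative q) * g +
        (aeval (coord Ω) q * (f * derivation Ω g) - aeval (coord Ω) q * (derivation Ω f * g)) := by
      simp only [lie_eq, Derivation.leibniz, derivation_aeval_coord, smul_eq_mul]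
      ring
    rwa [e, map_add, map_sub, hqI, hqI, sub_zero, add_zero] at h
  by_contra hfp
  -- Write q = (z - p)^m s. Then q divides s(z - p)q', so splitting f = f(p) + (z - p)f₁ in `hfq`
  -- puts s q' in the ideal when f(p) ≠ 0. But s q' vanishes at p only to order m - 1.
  obtain ⟨s, hs, hps⟩ := exists_eq_pow_rootMultiplicity_mul_and_not_dvd q hq0 p
  obtain ⟨f₁, hf₁⟩ : ∃ f₁, f = algebraMap ℂ _ (f.1 ⟨p, hpΩ⟩) + (coord Ω - algebraMap ℂ _ p) * f₁ :=
    exists_eq_add_sub_mul f ⟨p, hpΩ⟩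
  have hqs : q ∣ s * ((X - C p) * derivative q) := by
    have hk : (X - C p) * derivative ((X - C p) ^ q.rootMultiplicity p) =
        C (q.rootMultiplicity p : ℂ) * (X - C p) ^ q.rootMultiplicity p := by
      rcases q.rootMultiplicity p with _ | k
      · simp
      · rw [derivative_X_sub_C_pow, Nat.add_sub_cancel]
        ring
    generalize (X - C p) ^ q.rootMultiplicity p = P at hs hk
    refine ⟨C (q.rootMultiplicity p : ℂ) * s + (X - C p) * derivative s, ?_⟩
    generalize C (q.rootMultiplicity p : ℂ) = k at hk ⊢
    rw [hs, derivative_mul]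
    linear_combination s ^ 2 * hk
  have hsI : q ∣ s * derivative q := by
    rw [← hdvd]
    intro g
    have h1 := hfq (aeval (coord Ω) s * g)
    have h2 := (hdvd _).2 hqs (f₁ * g)
    rw [map_mul (aeval _), map_mul (aeval _), map_sub, aeval_X, aeval_C] at h2
    rw [hf₁] at h1
    have e : (algebraMap ℂ (𝒜 Ω) (f.1 ⟨p, hpΩ⟩) + (coord Ω - algebraMap ℂ (𝒜 Ω) p) * f₁) *
        aeval (coord Ω) (derivative q) * (aeval (coord Ω) s * g) =
        f.1 ⟨p, hpΩ⟩ • (aeval (coord Ω) (s * derivative q) * g) +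
        aeval (coord Ω) s * ((coord Ω - algebraMap ℂ (𝒜 Ω) p) *
          aeval (coord Ω) (derivative q)) * (f₁ * g) := by
      rw [Algebra.smul_def, map_mul]
      ring
    rw [e, map_add, h2, add_zero, map_smul, smul_eq_mul] at h1
    exact (mul_eq_zero.1 h1).resolve_left hfp
  have hs0 : s ≠ 0 := by
    rintro rfl
    exact hps (dvd_zero _)
  have hd0 : derivative q ≠ 0 := by
    intro h
    exact hdeg (by rw [eq_C_of_derivative_eq_zero h] at hq0 ⊢; exact degree_C (by simpa using hq0))
  have h := rootMultiplicity_le_rootMultiplicity_of_dvd (mul_ne_zero hs0 hd0) hsI p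
  rw [rootMultiplicity_mul (mul_ne_zero hs0 hd0), derivative_rootMultiplicity_of_root hp,
    rootMultiplicity_eq_zero (fun h => hps (dvd_iff_isRoot.2 h))] at h
  have := (rootMultiplicity_pos hq0).2 hp
  omega

end analyticFunctions

/-! ### Weighted composition form and continuity of the field automorphism -/

namespace analyticFunctions

open Filter Topology

variable {Ω₁ Ω₂ : Opens ℂ}

/-- A semilinear Lie ring isomorphism sends evaluation at a point to a multiple of evaluation at
some point. -/
theorem exists_apply_eq_mul (φ : 𝒜 Ω₁ ≃ₗ⁅ℤ⁆ 𝒜 Ω₂) (σ : ℂ ≃+* ℂ)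
    (hσ : ∀ (c : ℂ) (f : 𝒜 Ω₁), φ (c • f) = σ c • φ f) (w : Ω₂) :
    ∃ p : Ω₁, ∀ f, (φ f).1 w = σ (f.1 p) * (φ 1).1 w := by
  -- Applying σ⁻¹ undoes the semilinearity and leaves the kernel unchanged.
  let l : 𝒜 Ω₁ →ₗ[ℂ] ℂ :=
    { toFun := fun f => σ.symm ((φ f).1 w)
      map_add' := fun f g => by rw [map_add, add_apply, map_add]
      map_smul' := fun c f => by
        rw [hσ, smul_apply, map_mul, RingEquiv.symm_apply_apply]; rfl }
  have hl : ∀ f, σ (l f) = (φ f).1 w := fun f => σ.apply_symm_apply _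
  have hl' : ∀ f, l f = 0 ↔ (φ f).1 w = 0 := fun f => by rw [← hl, map_eq_zero_iff _ σ.injective]
  have hg₀ : l (φ.symm 1) = 1 := by
    apply σ.injective
    rw [hl, LieEquiv.apply_symm_apply, one_apply, map_one]
  obtain ⟨p, hp⟩ := exists_apply_eq_zero_of_lie_closed_ker l
    (fun h => by simp [h] at hg₀) fun f g hf hg => by
      rw [hl'] at hf hg ⊢
      rw [LieEquiv.map_lie, lie_eq, sub_apply, mul_apply, mul_apply, hf, hg]
      ring
  have key : ∀ f, f.1 p = l f * (φ.symm 1).1 p := by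
    intro f
    have h := hp (f - l f • φ.symm 1) (by rw [map_sub, map_smul, hg₀, smul_eq_mul, mul_one, sub_self])
    rwa [sub_apply, smul_apply, sub_eq_zero] at h
  refine ⟨p, fun f => ?_⟩
  rw [← hl, ← hl, ← map_mul, key f]
  congr 1
  have h1 := key 1
  rw [one_apply] at h1
  linear_combination l f * h1

/-- A Lie ring isomorphism is a weighted composition operator followed by a field automorphism. -/
theorem exists_eq_div_cderiv (hΩ₁ : IsConnected (Ω₁ : Set ℂ)) (hΩ₂ : IsConnected (Ω₂ : Set ℂ))
    (φ : 𝒜 Ω₁ ≃ₗ⁅ℤ⁆ 𝒜 Ω₂) :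
    ∃ (σ : ℂ ≃+* ℂ) (ψ : Ω₂ → Ω₁) (H : 𝒜 Ω₂),
      (∀ (c : ℂ) (f : 𝒜 Ω₁), φ (c • f) = σ c • φ f) ∧ (∀ w, H.1 w = σ (ψ w)) ∧
      (∀ w, cderiv H.1 w ≠ 0) ∧ ∀ (f : 𝒜 Ω₁) (w : Ω₂), (φ f).1 w = σ (f.1 (ψ w)) / cderiv H.1 w := by
  obtain ⟨σ, hσ⟩ := exists_ringEquiv_map_smul φ (exists_eq_smul_of_lie_eq_zero hΩ₁)
    (exists_eq_smul_of_lie_eq_zero hΩ₂) ⟨1, coord Ω₁, by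
      rw [one_lie_coord]; exact one_ne_zero_of_nonempty hΩ₁.nonempty⟩
  choose ψ hψ using exists_apply_eq_mul φ σ hσ
  have he : ∀ w, (φ 1).1 w ≠ 0 := by
    intro w h
    have := hψ w (φ.symm 1)
    rw [LieEquiv.apply_symm_apply, h, mul_zero, one_apply] at this
    exact one_ne_zero this
  let H : 𝒜 Ω₂ := ⟨_, IsAnalytic.div (φ (coord Ω₁)).2 (φ 1).2 he⟩
  have hH : φ (coord Ω₁) = H * φ 1 :=
    Subtype.ext (funext fun w => (div_mul_cancel₀ _ (he w)).symm)
  -- The bracket [φ(1), Hφ(1)] equals φ(1)²H', while [1, z] = 1 makes it φ(1).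
  have hH' : ∀ w, (φ 1).1 w * cderiv H.1 w = 1 := by
    intro w
    have h : ⁅φ 1, φ (coord Ω₁)⁆ = φ 1 := by rw [← LieEquiv.map_lie, one_lie_coord]
    rw [hH, lie_eq, Derivation.leibniz, smul_eq_mul, smul_eq_mul] at h
    have h' := congrFun (congrArg Subtype.val h) w
    simp only [sub_apply, mul_apply, add_apply, derivation_apply] at h'
    apply mul_left_cancel₀ (he w)
    linear_combination h'
  refine ⟨σ, ψ, H, hσ, fun w => ?_, fun w => right_ne_zero_of_mul_eq_one (hH' w), fun f w => ?_⟩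
  · exact (div_eq_iff (he w)).2 (hψ w (coord Ω₁))
  · rw [hψ, eq_div_iff (right_ne_zero_of_mul_eq_one (hH' w)), mul_assoc, hH', mul_one]

/-- If ψ(v) = ψ(w), surjectivity of φ gives g(v)d(v) = g(w)d(w) for every g; g = 1 and g = z then
force v = w. -/
theorem injective_of_apply_eq_div (φ : 𝒜 Ω₁ ≃ₗ⁅ℤ⁆ 𝒜 Ω₂) {σ : ℂ → ℂ} {ψ : Ω₂ → Ω₁} {d : Ω₂ → ℂ}
    (hd : ∀ w, d w ≠ 0) (hφ : ∀ (f : 𝒜 Ω₁) (w : Ω₂), (φ f).1 w = σ (f.1 (ψ w)) / d w) :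
    Function.Injective ψ := by
  intro v w h
  have key : ∀ g : 𝒜 Ω₂, g.1 v * d v = g.1 w * d w := by
    intro g
    have hv := hφ (φ.symm g) v
    have hw := hφ (φ.symm g) w
    rw [LieEquiv.apply_symm_apply, eq_div_iff (hd _)] at hv hw
    rw [hv, hw, h]
  have h1 := key 1
  have h2 := key (coord Ω₂)
  rw [one_apply, one_apply, one_mul, one_mul] at h1
  rw [h1] at h2
  exact Subtype.ext (mul_right_cancel₀ (hd w) h2)

/-- The test function z - ψ(ψ'(p)) has an image under φ vanishing at ψ'(p); applying φ⁻¹ shows that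
it vanishes at p. -/
theorem leftInverse_of_apply_eq_div (φ : 𝒜 Ω₁ ≃ₗ⁅ℤ⁆ 𝒜 Ω₂) {σ σ' : ℂ ≃+* ℂ} {ψ : Ω₂ → Ω₁}
    {ψ' : Ω₁ → Ω₂} {d : Ω₂ → ℂ} {d' : Ω₁ → ℂ}
    (hφ : ∀ (f : 𝒜 Ω₁) (w : Ω₂), (φ f).1 w = σ (f.1 (ψ w)) / d w)
    (hφ' : ∀ (f : 𝒜 Ω₂) (w : Ω₁), (φ.symm f).1 w = σ' (f.1 (ψ' w)) / d' w) :
    Function.LeftInverse ψ ψ' := by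
  intro p
  have h := hφ' (φ (coord Ω₁ - algebraMap ℂ _ (ψ (ψ' p) : ℂ))) p
  rw [hφ, LieEquiv.symm_apply_apply, sub_algebraMap_apply, sub_algebraMap_apply, coord_apply,
    coord_apply, sub_self, map_zero, zero_div, map_zero, zero_div, sub_eq_zero] at h
  exact Subtype.ext h.symm

theorem exists_injective_seq_tendsto (Ω : Opens ℂ) (w : Ω) :
    ∃ s : ℕ → Ω, Function.Injective s ∧ Tendsto s atTop (𝓝 w) := by
  obtain ⟨r, hr, hball⟩ := Metric.mem_nhds_iff.1 (Ω.isOpen.mem_nhds w.2)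
  have hpos : ∀ n : ℕ, (0 : ℝ) < n + 2 := fun n => by positivity
  have hmem : ∀ n : ℕ, (w + (r / (n + 2) : ℝ) : ℂ) ∈ Ω := by
    intro n
    apply hball
    rw [Metric.mem_ball, dist_self_add_left, Complex.norm_real, Real.norm_of_nonneg
      (by have := hpos n; positivity), div_lt_iff₀ (hpos n)]
    nlinarith [hpos n]
  refine ⟨fun n => ⟨_, hmem n⟩, fun m n h => ?_, ?_⟩
  · have h := add_left_cancel (Subtype.ext_iff.1 h)
    rw [Complex.ofReal_inj, div_eq_div_iff (hpos m).ne' (hpos n).ne', mul_right_inj' hr.ne',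
      add_left_inj, Nat.cast_inj] at h
    exact h.symm
  · rw [tendsto_subtype_rng]
    have h : Tendsto (fun n : ℕ => r / ((n : ℝ) + 2)) atTop (𝓝 0) :=
      Tendsto.div_atTop tendsto_const_nhds
        (tendsto_natCast_atTop_atTop.atTop_add tendsto_const_nhds)
    have h2 := ((Complex.continuous_ofReal.tendsto 0).comp h).const_add (w : ℂ)
    rwa [Complex.ofReal_zero, add_zero] at h2

/-- The field automorphism attached to a Lie ring isomorphism is continuous. -/
theorem continuous_of_apply_eq_div (φ : 𝒜 Ω₁ ≃ₗ⁅ℤ⁆ 𝒜 Ω₂) {σ : ℂ ≃+* ℂ} {ψ : Ω₂ → Ω₁}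
    {d : 𝒜 Ω₂} (hd : ∀ w, d.1 w ≠ 0)
    (hφ : ∀ (f : 𝒜 Ω₁) (w : Ω₂), (φ f).1 w = σ (f.1 (ψ w)) / d.1 w) (w : Ω₂) :
    Continuous σ := by
  by_contra hσ
  have hunb : ∀ δ > 0, ∀ M : ℝ, ∃ z : ℂ, ‖z‖ < δ ∧ M < ‖(σ : ℂ →+* ℂ) z‖ := by
    by_contra! h
    obtain ⟨δ, hδ, M, h⟩ := h
    exact hσ (continuous_of_norm_le (σ : ℂ →+* ℂ) hδ h)
  obtain ⟨s, hs, hsw⟩ := exists_injective_seq_tendsto Ω₂ w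
  obtain ⟨F, hF, hle⟩ := exists_entire_le_norm (σ : ℂ →+* ℂ) (fun n => ψ (s n))
    (Subtype.val_injective.comp ((injective_of_apply_eq_div φ hd hφ).comp hs)) hunb
  let f : 𝒜 Ω₁ := ⟨_, IsAnalytic.restrict Ω₁ hF⟩
  -- Multiplication by `d` clears the denominator: at `s n` the product is σ(F(ψ(s n))), of norm at
  -- least n.
  have hlim : Tendsto (fun n => ‖(φ f * d).1 (s n)‖) atTop (𝓝 ‖(φ f * d).1 w‖) :=
    ((IsAnalytic.continuous (φ f * d).2).norm.tendsto w).comp hsw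
  refine not_tendsto_atTop_of_tendsto_nhds hlim
    (tendsto_atTop_mono (fun n => ?_) tendsto_natCast_atTop_atTop)
  rw [mul_apply, hφ, div_mul_cancel₀ _ (hd _)]
  exact hle n

end analyticFunctions

/-! ### The conformal and anti-conformal cases -/

theorem IsAnalytic.conj_comp_conj {Ω : Opens ℂ} {f : Ω → ℂ} (hf : IsAnalytic f) :
    IsAnalytic fun w : conjOpens Ω => conj (f ((conjEquiv Ω).symm w)) := by
  refine isAnalytic_of_eq (F := fun v => conj (zeroExt f (conj v))) (fun w => ?_) fun w => ?_
  · exact congrArg conj (zeroExt_apply f ((conjEquiv Ω).symm w)).symm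
  · refine DifferentiableOn.analyticAt (s := conjOpens Ω) (fun v hv => ?_)
      ((conjOpens Ω).isOpen.mem_nhds w.2)
    have h := DifferentiableAt.conj_conj (hf ⟨conj v, hv⟩).differentiableAt
    rw [Complex.conj_conj] at h
    exact h.differentiableWithinAt

open analyticFunctions in
theorem mainTheorem5 (Ω₁ Ω₂ : Opens ℂ) (hΩ₁ : IsConnected (Ω₁ : Set ℂ))
    (hΩ₂ : IsConnected (Ω₂ : Set ℂ)) (φ : 𝒜 Ω₁ ≃ₗ⁅ℤ⁆ 𝒜 Ω₂) :
    ∃ γ : Ω₁ ≃ Ω₂,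
      (IsConformal γ ∧ ∀ (f : 𝒜 Ω₁) (w : Ω₂),
        (φ f).1 w = f.1 (γ.symm w) / cderiv (fun v => (γ.symm v : ℂ)) w) ∨
      (IsAntiConformal γ ∧ ∀ (f : 𝒜 Ω₁) (w : Ω₂),
        (φ f).1 w = conj (f.1 (γ.symm w)) / cderiv (fun v => conj (γ.symm v : ℂ)) w) := by
  obtain ⟨σ, ψ, H, hσ, hH, hd, hφ⟩ := exists_eq_div_cderiv hΩ₁ hΩ₂ φ
  obtain ⟨σ', ψ', H', hσ', hH', hd', hφ'⟩ := exists_eq_div_cderiv hΩ₂ hΩ₁ φ.symm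
  obtain ⟨w₀, hw₀⟩ := hΩ₂.nonempty
  have hcont : Continuous (σ : ℂ →+* ℂ) :=
    continuous_of_apply_eq_div φ (d := derivation Ω₂ H) hd hφ ⟨w₀, hw₀⟩
  have hψ : Function.LeftInverse ψ ψ' := leftInverse_of_apply_eq_div φ hφ hφ'
  have hψ' : Function.LeftInverse ψ' ψ := leftInverse_of_apply_eq_div φ.symm hφ' hφ
  have hσσ' : ∀ c, σ' (σ c) = c := by
    intro c
    have h := hσ' (σ c) (φ 1)
    rw [← hσ, LieEquiv.symm_apply_apply, LieEquiv.symm_apply_apply] at h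
    exact (smul_left_injective ℂ (one_ne_zero_of_nonempty hΩ₁.nonempty) h).symm
  refine ⟨⟨ψ', ψ, hψ, hψ'⟩, ?_⟩
  rcases Complex.ringHom_eq_id_or_conj_of_continuous hcont with h | h
  · have hid : ∀ c, σ c = c := fun c => RingHom.congr_fun h c
    have hid' : ∀ c, σ' c = c := fun c => by conv_lhs => rw [← hid c, hσσ']
    have hfun : H.1 = fun w => (ψ w : ℂ) := funext fun w => (hH w).trans (hid _)
    have hfun' : H'.1 = fun w => (ψ' w : ℂ) := funext fun w => (hH' w).trans (hid' _)
    refine Or.inl ⟨⟨hfun' ▸ H'.2, hfun ▸ H.2⟩, fun f w => ?_⟩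
    rw [hφ, hid, hfun]
    rfl
  · have hconj : ∀ c, σ c = conj c := fun c => RingHom.congr_fun h c
    have hconj' : ∀ c, σ' c = conj c := fun c => by
      conv_lhs => rw [← Complex.conj_conj c, ← hconj, hσσ']
    have hfun : H.1 = fun w => conj (ψ w : ℂ) := funext fun w => (hH w).trans (hconj _)
    have hfun' : H'.1 = fun w => conj (ψ' w : ℂ) := funext fun w => (hH' w).trans (hconj' _)
    refine Or.inr ⟨⟨hfun' ▸ H'.2, ?_⟩, fun f w => ?_⟩
    -- The inverse of the conjugate of γ is w ↦ ψ(conj w), which is H conjugated on both sides.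
    · have hc := IsAnalytic.conj_comp_conj H.2
      simp only [hfun, Complex.conj_conj] at hc
      exact hc
    · rw [hφ, hconj, hfun]
      rfl
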